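/- Consider finite-dimensional bipartite systems $\mathbb{C}^{p}\otimes\mathbb{C}^{q}$ shared by Alice (first factor) and Bob (second factor). A pure state is a unit vector $\phi\in\mathbb{C}^{p}\otimes\mathbb{C}^{q}$; it is separable if $\phi=u\otimes v$ for some $u\in\mathbb{C}^p$, $v\in\mathbb{C}^q$. It is maximally entangled if there are an integer $r\ge 2$ and orthonormal families $e_1,\dots,e_r$ in $\mathbb{C}^{p}$ and $f_1,\dots,f_r$ in $\mathbb{C}^{q}$ with $\phi=\frac{1}{\sqrt r}\sum_{k=1}^{r}e_k\otimes f_k$. For $d\ge 1$ let $\Psi_d^+=\frac{1}{\sqrt d}\sum_{i=1}^{d}|i\rangle\otimes|i\rangle\in\mathbb{C}^d\otimes\mathbb{C}^d$. The $n$-fold tensor power $\phi^{\otimes n}$ is regarded as a bipartite state in which Alice holds the $n$ first factors and Bob the $n$ second factors. A (deterministic) LOCC operation is a map on operators obtained by a finite sequence of rounds; in each round one party performs a generalized measurement on the local system (finitely many outcomes $i$, outcome $i$ acting by $\rho\mapsto\sum_k E_{ik}\rho E_{ik}^\dagger$ with local Kraus operators, possibly into a space of a different finite dimension, where $\sum_{i,k}E_{ik}^\dagger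 E_{ik}=I$) and communicates the outcome to the other party, and the later rounds may depend on all earlier outcomes; the final result is summed over all outcomes. For pure states $\phi,\psi$ of possibly different bipartite systems write $\phi\to\psi$ if some LOCC operation maps $|\phi\rangle\langle\phi|$ to $|\psi\rangle\langle\psi|$, and $\phi\sim\psi$ if $\phi\to\psi$ and $\psi\to\phi$. **Theorem.** Let $\phi\in\mathbb{C}^{d_A}\otimes\mathbb{C}^{d_B}$ be a pure state that is not maximally entangled and let $d\ge 1$; if $d=1$, assume moreover that $\phi$ is not separable. Then there exist no positive integers $n$ and $m$ such that $$\phi^{\otimes n}\sim\Psi_d^{+\,\otimes m}.$$ -/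

import Mathlib

open scoped Kronecker Matrix

namespace Entanglement

noncomputable section

/-! ## Bipartite states

Alice holds `ℂ^p` and Bob holds `ℂ^q`; the joint space `ℂ^p ⊗ ℂ^q` is written in the product basis
`|i⟩ ⊗ |j⟩`, indexed by `Fin p × Fin q`. -/

/-- The Hilbert space `ℂ^p ⊗ ℂ^q` of a `p × q` bipartite system. Pure states are its unit vectors. -/
abbrev Vec (p q : ℕ) : Type := EuclideanSpace ℂ (Fin p × Fin q)

/-- Operators on the Hilbert space of a `p × q` bipartite system. -/
abbrev Op (p q : ℕ) : Type := Matrix (Fin p × Fin q) (Fin p × Fin q) ℂ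

/-- The density matrix `|φ⟩⟨φ|` of a pure state. -/
def density {p q : ℕ} (φ : Vec p q) : Op p q :=
  Matrix.of fun x y => φ x * star (φ y)

/-- `φ = u ⊗ v` for some vector `u` of Alice and some vector `v` of Bob. -/
def IsSeparable {p q : ℕ} (φ : Vec p q) : Prop :=
  ∃ (u : EuclideanSpace ℂ (Fin p)) (v : EuclideanSpace ℂ (Fin q)), ∀ i j, φ (i, j) = u i * v j

/-- `n` copies of `φ`, seen as a state of the bipartite system in which Alice holds the `n` copies
of her part and Bob holds the `n` copies of his. The basis of `(ℂ^p)^{⊗n}` consists of the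
sequences `Fin n → Fin p`, which are numbered by `Fin (p ^ n)` through `finFunctionFinEquiv`. -/
def tensorPower {p q : ℕ} (φ : Vec p q) (n : ℕ) : Vec (p ^ n) (q ^ n) :=
  WithLp.toLp 2 fun x =>
    ∏ k : Fin n, φ (finFunctionFinEquiv.symm x.1 k, finFunctionFinEquiv.symm x.2 k)

/-- The standard maximally entangled state `Ψ_d⁺ = (1 / √d) ∑ i, |i⟩ ⊗ |i⟩` of a `d × d` system. -/
def maxEntangled (d : ℕ) : Vec d d :=
  WithLp.toLp 2 fun x => if x.1 = x.2 then ((1 / Real.sqrt d : ℝ) : ℂ) else 0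

/-- `φ` is a maximally entangled state in `r` dimensions for some `r ≥ 2`: it is
`(1 / √r) ∑ k, |e k⟩ ⊗ |f k⟩` for orthonormal families `e` of Alice and `f` of Bob. Here `r` may
be smaller than the dimensions of the two local spaces. -/
def IsMaximallyEntangled {p q : ℕ} (φ : Vec p q) : Prop :=
  ∃ r : ℕ, 2 ≤ r ∧
    ∃ (e : Fin r → EuclideanSpace ℂ (Fin p)) (f : Fin r → EuclideanSpace ℂ (Fin q)),
      Orthonormal ℂ e ∧ Orthonormal ℂ f ∧
        ∀ i j, φ (i, j) = ((1 / Real.sqrt r : ℝ) : ℂ) * ∑ k, e k i * f k j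

/-! ## Local operations and classical communication -/

/-- The operation `ρ ↦ ∑ k, E k ρ (E k)†` with Kraus operators `E k`. -/
def krausMap {m m' κ : Type*} [Fintype m] [Fintype κ] (E : κ → Matrix m' m ℂ) :
    Matrix m m ℂ →ₗ[ℂ] Matrix m' m' ℂ where
  toFun ρ := ∑ k, E k * ρ * (E k)ᴴ
  map_add' ρ σ := by simp [Matrix.mul_add, Matrix.add_mul, Finset.sum_add_distrib]
  map_smul' c ρ := by simp [Finset.smul_sum]

/-- A generalized measurement on a system `ℂ^p`: finitely many outcomes, where outcome `i` leaves
a system `ℂ^(dim i)` and applies the quantum operation with Kraus operators `kraus i k`; all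
outcomes together are trace preserving. With one outcome this is a general deterministic quantum
operation, possibly one that changes the dimension. -/
structure Instrument (p : ℕ) where
  outcomes : ℕ
  dim : Fin outcomes → ℕ
  numKraus : Fin outcomes → ℕ
  kraus : ∀ i, Fin (numKraus i) → Matrix (Fin (dim i)) (Fin p) ℂ
  complete : ∑ i, ∑ k, (kraus i k)ᴴ * kraus i k = 1

/-- The operation `ℰ i ⊗ id` when Alice measures `M` and obtains outcome `i`. -/
def Instrument.onAlice {p : ℕ} (M : Instrument p) (q : ℕ) (i : Fin M.outcomes) :
    Op p q →ₗ[ℂ] Op (M.dim i) q :=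
  krausMap fun k => M.kraus i k ⊗ₖ (1 : Matrix (Fin q) (Fin q) ℂ)

/-- The operation `id ⊗ ℰ i` when Bob measures `M` and obtains outcome `i`. -/
def Instrument.onBob {q : ℕ} (M : Instrument q) (p : ℕ) (i : Fin M.outcomes) :
    Op p q →ₗ[ℂ] Op p (M.dim i) :=
  krausMap fun k => (1 : Matrix (Fin p) (Fin p) ℂ) ⊗ₖ M.kraus i k

/-- The deterministic LOCC operations from `p × q` systems to `p' × q'` systems. A protocol either
stops, or one party performs a generalized measurement on the local system, announces the outcome
`i` to the other party, and both continue with an LOCC protocol `Λ i` that may depend on `i`.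
The number of rounds, the number of outcomes and the intermediate dimensions are finite but
unbounded, and communication goes in both directions. -/
inductive IsLOCC {p' q' : ℕ} : ∀ {p q : ℕ}, (Op p q →ₗ[ℂ] Op p' q') → Prop
  | finish : IsLOCC (p := p') (q := q') LinearMap.id
  | alice {p q : ℕ} (M : Instrument p) (Λ : ∀ i, Op (M.dim i) q →ₗ[ℂ] Op p' q')
      (h : ∀ i, IsLOCC (Λ i)) : IsLOCC (∑ i, Λ i ∘ₗ M.onAlice q i)
  | bob {p q : ℕ} (M : Instrument q) (Λ : ∀ i, Op p (M.dim i) →ₗ[ℂ] Op p' q')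
      (h : ∀ i, IsLOCC (Λ i)) : IsLOCC (∑ i, Λ i ∘ₗ M.onBob p i)

/-- `ρ → σ`: some deterministic LOCC operation maps `ρ` to `σ`. -/
def Transforms {p q p' q' : ℕ} (ρ : Op p q) (σ : Op p' q') : Prop :=
  ∃ Λ : Op p q →ₗ[ℂ] Op p' q', IsLOCC Λ ∧ Λ ρ = σ

/-- `φ ∼ ψ`: each of the two pure states can be turned into the other by deterministic LOCC. -/
def Interconvertible {p q p' q' : ℕ} (φ : Vec p q) (ψ : Vec p' q') : Prop :=
  Transforms (density φ) (density ψ) ∧ Transforms (density ψ) (density φ)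

end

end Entanglement

namespace Entanglement

open scoped ComplexOrder

/-! Write `φ = ∑ k, e k ⊗ g k` in Schmidt form, with `r` terms and squared coefficients `l k > 0` of
sum 1. Every LOCC operation is a sum of product Kraus operators (`IsLOCC.isSeparableMap`), and if
such an operation maps a pure state to a pure state, each Kraus operator sends the source to a
multiple of the target (`eq_smul_of_sum_vecMulVec`). Two monotones follow: the Schmidt rank cannot
grow (`Transforms.rank_le`), and any bound on the squared overlap of the target with product vectors
also holds for the source (`Transforms.overlap_le`).

Both are multiplicative enough under tensor powers. The direction `Ψ → φ` gives `r ^ n ≤ d ^ m`; the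
direction `φ → Ψ` gives `l k ^ n ≤ 1 / d ^ m`. So each `l k ≤ 1 / r`, and since the `r` numbers sum
to 1 they all equal `1 / r`. A flat spectrum means maximally entangled if `r ≥ 2`; if `r = 1` then
`φ` is separable and `d = 1`. -/

/-! ## Separable maps -/

/-- A trace-preserving map whose Kraus operators are product operators. -/
def IsSeparableMap {p q p' q' : ℕ} (Λ : Op p q →ₗ[ℂ] Op p' q') : Prop :=
  ∃ (κ : Type) (_ : Fintype κ) (A : κ → Matrix (Fin p') (Fin p) ℂ)
    (B : κ → Matrix (Fin q') (Fin q) ℂ),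
    Λ = krausMap (fun k => A k ⊗ₖ B k) ∧ ∑ k, (A k ⊗ₖ B k)ᴴ * (A k ⊗ₖ B k) = 1

theorem krausMap_apply {m m' κ : Type*} [Fintype m] [Fintype κ] (E : κ → Matrix m' m ℂ)
    (ρ : Matrix m m ℂ) : krausMap E ρ = ∑ k, E k * ρ * (E k)ᴴ := rfl

/-- One round followed by its continuations. Products of product operators are product operators,
and the completeness relation of each continuation collapses inside that of the round. With `C` or
`D` the identity this serves both parties. -/
theorem isSeparableMap_sum_comp {p q p' q' : ℕ} {ι : Type} [Fintype ι] {s t : ι → ℕ}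
    {κ : ι → Type} [∀ i, Fintype (κ i)]
    (C : ∀ i, κ i → Matrix (Fin (s i)) (Fin p) ℂ) (D : ∀ i, κ i → Matrix (Fin (t i)) (Fin q) ℂ)
    (hCD : ∑ i, ∑ k, (C i k ⊗ₖ D i k)ᴴ * (C i k ⊗ₖ D i k) = 1)
    (Λ : ∀ i, Op (s i) (t i) →ₗ[ℂ] Op p' q') (hΛ : ∀ i, IsSeparableMap (Λ i)) :
    IsSeparableMap (∑ i, Λ i ∘ₗ krausMap fun k => C i k ⊗ₖ D i k) := by
  choose μ hμ A B hAB hone using hΛ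
  refine ⟨Σ i, κ i × μ i, inferInstance, fun x => A x.1 x.2.2 * C x.1 x.2.1,
    fun x => B x.1 x.2.2 * D x.1 x.2.1, ?_, ?_⟩
  · ext1 ρ
    simp only [LinearMap.sum_apply, LinearMap.comp_apply, hAB, krausMap_apply,
      Fintype.sum_sigma, Fintype.sum_prod_type, Matrix.mul_kronecker_mul,
      Matrix.conjTranspose_mul, Matrix.mul_sum, Matrix.sum_mul]
    refine Finset.sum_congr rfl fun i _ => ?_
    rw [Finset.sum_comm]
    simp only [Matrix.mul_assoc]
  · rw [← hCD]
    simp only [Fintype.sum_sigma, Fintype.sum_prod_type, Matrix.mul_kronecker_mul,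
      Matrix.conjTranspose_mul]
    refine Finset.sum_congr rfl fun i _ => Finset.sum_congr rfl fun k _ => ?_
    calc _ = (C i k ⊗ₖ D i k)ᴴ * (∑ j, (A i j ⊗ₖ B i j)ᴴ * (A i j ⊗ₖ B i j)) *
          (C i k ⊗ₖ D i k) := by
          simp only [Matrix.mul_sum, Matrix.sum_mul, Matrix.mul_assoc]
      _ = _ := by rw [hone, Matrix.mul_one]

theorem IsLOCC.isSeparableMap {p q p' q' : ℕ} {Λ : Op p q →ₗ[ℂ] Op p' q'} (h : IsLOCC Λ) :
    IsSeparableMap Λ := by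
  induction h with
  | finish =>
    refine ⟨Unit, inferInstance, fun _ => 1, fun _ => 1, ?_, by simp⟩
    ext1 ρ
    simp [krausMap_apply]
  | @alice p q M Λ _ ih =>
    refine isSeparableMap_sum_comp M.kraus (fun _ _ => (1 : Matrix (Fin q) (Fin q) ℂ)) ?_ Λ ih
    simp only [Matrix.conjTranspose_kronecker, ← Matrix.mul_kronecker_mul]
    have hadd := fun X Y : Matrix (Fin p) (Fin p) ℂ => Matrix.add_kronecker X Y (1 : Matrix (Fin q) (Fin q) ℂ)
    -- An additive map, so that the local completeness relation can be carried through the double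
    -- sum.
    let f : Matrix (Fin p) (Fin p) ℂ →+ Op p q :=
      ⟨⟨fun X => X ⊗ₖ (1 : Matrix (Fin q) (Fin q) ℂ), Matrix.zero_kronecker _⟩, hadd⟩
    have h' : f (∑ i, ∑ k, (M.kraus i k)ᴴ * M.kraus i k) = 1 := by
      rw [M.complete]; exact Matrix.one_kronecker_one
    simp only [map_sum] at h'
    simpa [f] using h'
  | @bob p q M Λ _ ih =>
    refine isSeparableMap_sum_comp (fun _ _ => (1 : Matrix (Fin p) (Fin p) ℂ)) M.kraus ?_ Λ ih
    simp only [Matrix.conjTranspose_kronecker, ← Matrix.mul_kronecker_mul]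
    have hadd := fun X Y : Matrix (Fin q) (Fin q) ℂ => Matrix.kronecker_add (1 : Matrix (Fin p) (Fin p) ℂ) X Y
    let f : Matrix (Fin q) (Fin q) ℂ →+ Op p q :=
      ⟨⟨fun X => (1 : Matrix (Fin p) (Fin p) ℂ) ⊗ₖ X, Matrix.kronecker_zero _⟩, hadd⟩
    have h' : f (∑ i, ∑ k, (M.kraus i k)ᴴ * M.kraus i k) = 1 := by
      rw [M.complete]; exact Matrix.one_kronecker_one
    simp only [map_sum] at h'
    simpa [f] using h'

theorem Transforms.exists_kraus {p q p' q' : ℕ} {ρ : Op p q} {σ : Op p' q'}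
    (h : Transforms ρ σ) : ∃ (κ : Type) (_ : Fintype κ) (A : κ → Matrix (Fin p') (Fin p) ℂ)
      (B : κ → Matrix (Fin q') (Fin q) ℂ),
      ∑ k, (A k ⊗ₖ B k) * ρ * (A k ⊗ₖ B k)ᴴ = σ ∧
        ∑ k, (A k ⊗ₖ B k)ᴴ * (A k ⊗ₖ B k) = 1 := by
  obtain ⟨Λ, hΛ, rfl⟩ := h
  obtain ⟨κ, hκ, A, B, rfl, h1⟩ := hΛ.isSeparableMap
  exact ⟨κ, hκ, A, B, rfl, h1⟩

/-! ## Kraus operators mapping a pure state to a pure state -/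

theorem mul_vecMulVec_star_mul {m m' : Type*} [Fintype m] (K : Matrix m' m ℂ) (v : m → ℂ) :
    K * Matrix.vecMulVec v (star v) * Kᴴ =
      Matrix.vecMulVec (K *ᵥ v) (star (K *ᵥ v)) := by
  rw [Matrix.mul_vecMulVec, Matrix.vecMulVec_mul, Matrix.star_mulVec]

theorem density_eq_vecMulVec {p q : ℕ} (φ : Vec p q) :
    density φ = Matrix.vecMulVec φ.ofLp (star φ.ofLp) := rfl

theorem star_dotProduct_vecMulVec_mulVec {m : Type*} [Fintype m] (v w : m → ℂ) :
    star w ⬝ᵥ (Matrix.vecMulVec v (star v) *ᵥ w) = ((‖star w ⬝ᵥ v‖ ^ 2 : ℝ) : ℂ) := by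
  have h : star v ⬝ᵥ w = star (star w ⬝ᵥ v) := Matrix.star_dotProduct _ _
  rw [Matrix.vecMulVec_mulVec, h]
  rw [dotProduct_smul, MulOpposite.smul_eq_mul_unop, MulOpposite.unop_op]
  push_cast
  exact Complex.mul_conj' _

theorem star_dotProduct_self_eq {m : Type*} [Fintype m] (v : m → ℂ) :
    star v ⬝ᵥ v = ((∑ i, ‖v i‖ ^ 2 : ℝ) : ℂ) := by
  push_cast
  exact Finset.sum_congr rfl fun i _ => Complex.conj_mul' _

theorem sum_norm_sq_dotProduct {m κ : Type*} [Fintype m] [Fintype κ] {v : κ → m → ℂ} {ψ : m → ℂ}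
    (h : ∑ k, Matrix.vecMulVec (v k) (star (v k)) = Matrix.vecMulVec ψ (star ψ)) (w : m → ℂ) :
    ∑ k, ‖star w ⬝ᵥ v k‖ ^ 2 = ‖star w ⬝ᵥ ψ‖ ^ 2 := by
  have h' := congrArg (fun X => star w ⬝ᵥ (X *ᵥ w)) h
  simp only [Matrix.sum_mulVec, dotProduct_sum, star_dotProduct_vecMulVec_mulVec] at h'
  exact_mod_cast h'

/-- Pure states are extreme: at the component `w` of `v k` orthogonal to `ψ` the quadratic form of
the sum vanishes, hence so does each nonnegative term, and `w` is orthogonal to `v k` and thus to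
itself. -/
theorem eq_smul_of_sum_vecMulVec {m κ : Type*} [Fintype m] [Fintype κ] {v : κ → m → ℂ}
    {ψ : m → ℂ} (hψ : star ψ ⬝ᵥ ψ = 1)
    (h : ∑ k, Matrix.vecMulVec (v k) (star (v k)) = Matrix.vecMulVec ψ (star ψ)) (k : κ) :
    v k = (star ψ ⬝ᵥ v k) • ψ := by
  set c := star ψ ⬝ᵥ v k with hc
  set w := v k - c • ψ with hw
  have h0 : star ψ ⬝ᵥ w = 0 := by
    rw [hw, dotProduct_sub, dotProduct_smul, hψ, ← hc]; simp
  have h1 : star w ⬝ᵥ ψ = 0 := by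
    rw [Matrix.star_dotProduct, h0, star_zero]
  have h2 := sum_norm_sq_dotProduct h w
  rw [h1, norm_zero, zero_pow two_ne_zero,
    Finset.sum_eq_zero_iff_of_nonneg fun _ _ => by positivity] at h2
  have h3 : star w ⬝ᵥ v k = 0 := by simpa using h2 k (Finset.mem_univ k)
  have h4 : star w ⬝ᵥ w = 0 := by
    conv_lhs => rw [hw]
    rw [dotProduct_sub, dotProduct_smul, ← hw, h3, h1]; simp
  exact sub_eq_zero.mp (dotProduct_star_self_eq_zero.mp h4)

theorem norm_sum_mul_sq_le {ι : Type*} [Fintype ι] (x y : ι → ℂ) :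
    ‖∑ i, x i * y i‖ ^ 2 ≤ (∑ i, ‖x i‖ ^ 2) * ∑ i, ‖y i‖ ^ 2 := by
  calc ‖∑ i, x i * y i‖ ^ 2 ≤ (∑ i, ‖x i‖ * ‖y i‖) ^ 2 := by
        gcongr
        exact (norm_sum_le _ _).trans_eq (by simp)
    _ ≤ _ := Finset.sum_mul_sq_le_sq_mul_sq _ _ _

/-! ## Two monotones -/

/-- The matrix of coefficients of a bipartite vector. -/
def coeffMatrix {p q : ℕ} (φ : Vec p q) : Matrix (Fin p) (Fin q) ℂ :=
  Matrix.of fun i j => φ (i, j)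

/-- The product vector `u ⊗ v`. -/
def productVec {m n : Type*} (u : m → ℂ) (v : n → ℂ) : m × n → ℂ := fun x => u x.1 * v x.2

theorem kronecker_mulVec_productVec {m n m' n' : Type*} [Fintype m] [Fintype n]
    (A : Matrix m' m ℂ) (B : Matrix n' n ℂ) (u : m → ℂ) (v : n → ℂ) :
    (A ⊗ₖ B) *ᵥ productVec u v = productVec (A *ᵥ u) (B *ᵥ v) := by
  ext ⟨i, j⟩
  simp only [Matrix.mulVec, dotProduct, productVec, Matrix.kroneckerMap_apply,
    Fintype.sum_prod_type, Finset.sum_mul_sum]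
  exact Finset.sum_congr rfl fun _ _ => Finset.sum_congr rfl fun _ _ => by ring

theorem sum_norm_sq_productVec {m n : Type*} [Fintype m] [Fintype n] (u : m → ℂ) (v : n → ℂ) :
    ∑ x, ‖productVec u v x‖ ^ 2 = (∑ i, ‖u i‖ ^ 2) * ∑ j, ‖v j‖ ^ 2 := by
  simp [productVec, Fintype.sum_prod_type, Finset.sum_mul_sum, mul_pow]

theorem kronecker_mulVec_apply {p q p' q' : ℕ} (A : Matrix (Fin p') (Fin p) ℂ)
    (B : Matrix (Fin q') (Fin q) ℂ) (φ : Vec p q) (i : Fin p') (j : Fin q') :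
    ((A ⊗ₖ B) *ᵥ φ.ofLp) (i, j) = (A * coeffMatrix φ * Bᵀ) i j := by
  simp only [Matrix.mulVec, dotProduct, Matrix.kroneckerMap_apply, Fintype.sum_prod_type,
    Matrix.mul_apply, coeffMatrix, Matrix.of_apply, Matrix.transpose_apply, Finset.sum_mul]
  rw [Finset.sum_comm]
  exact Finset.sum_congr rfl fun _ _ => Finset.sum_congr rfl fun _ _ => by ring

theorem star_dotProduct_eq_one {p q : ℕ} {φ : Vec p q} (h : ‖φ‖ = 1) :
    star φ.ofLp ⬝ᵥ φ.ofLp = 1 := by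
  rw [star_dotProduct_self_eq, ← EuclideanSpace.norm_sq_eq, h]; simp

theorem sum_vecMulVec_of_sum_density {p q p' q' : ℕ} {κ : Type*} [Fintype κ]
    {K : κ → Matrix (Fin p' × Fin q') (Fin p × Fin q) ℂ} {φ : Vec p q} {ψ : Vec p' q'}
    (h : ∑ k, K k * density φ * (K k)ᴴ = density ψ) :
    ∑ k, Matrix.vecMulVec (K k *ᵥ φ.ofLp) (star (K k *ᵥ φ.ofLp)) =
      Matrix.vecMulVec ψ.ofLp (star ψ.ofLp) := by
  simpa only [density_eq_vecMulVec, mul_vecMulVec_star_mul] using h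

/-- A product operator acts on coefficient matrices by `N ↦ A * N * Bᵀ`, and at least one branch
reaches `ψ` with nonzero amplitude. -/
theorem Transforms.rank_le {p q p' q' : ℕ} {φ : Vec p q} {ψ : Vec p' q'} (hψ : ‖ψ‖ = 1)
    (h : Transforms (density φ) (density ψ)) :
    (coeffMatrix ψ).rank ≤ (coeffMatrix φ).rank := by
  obtain ⟨κ, _, A, B, hK, -⟩ := h.exists_kraus
  have hv := sum_vecMulVec_of_sum_density hK
  have hψ' := star_dotProduct_eq_one hψ
  have hc := sum_norm_sq_dotProduct hv ψ.ofLp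
  rw [hψ'] at hc
  obtain ⟨k, hk⟩ : ∃ k, star ψ.ofLp ⬝ᵥ ((A k ⊗ₖ B k) *ᵥ φ.ofLp) ≠ 0 := by
    by_contra! hk
    simp [hk] at hc
  have he := eq_smul_of_sum_vecMulVec hψ' hv k
  set c := star ψ.ofLp ⬝ᵥ ((A k ⊗ₖ B k) *ᵥ φ.ofLp)
  have hm : coeffMatrix ψ = (c⁻¹ • A k) * coeffMatrix φ * (B k)ᵀ := by
    ext i j
    rw [Matrix.smul_mul, Matrix.smul_mul, Matrix.smul_apply, ← kronecker_mulVec_apply, he]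
    simp [coeffMatrix, hk]
  rw [hm]
  exact (Matrix.rank_mul_le_left _ _).trans (Matrix.rank_mul_le_right _ _)

/-- The best `C` is the largest squared Schmidt coefficient of `ψ`. Completeness splits the overlap
of `φ` with `a ⊗ b` into overlaps of `ψ` with the product vectors `A k a ⊗ B k b`, weighted by
amplitudes whose squared moduli sum to 1; Cauchy–Schwarz then applies. -/
theorem Transforms.overlap_le {p q p' q' : ℕ} {φ : Vec p q} {ψ : Vec p' q'} (hψ : ‖ψ‖ = 1)
    (h : Transforms (density φ) (density ψ)) {C : ℝ}
    (hC : ∀ u v, ‖star ψ.ofLp ⬝ᵥ productVec u v‖ ^ 2 ≤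
      C * ((∑ i, ‖u i‖ ^ 2) * ∑ j, ‖v j‖ ^ 2)) (a : Fin p → ℂ) (b : Fin q → ℂ) :
    ‖star φ.ofLp ⬝ᵥ productVec a b‖ ^ 2 ≤ C * ((∑ i, ‖a i‖ ^ 2) * ∑ j, ‖b j‖ ^ 2) := by
  obtain ⟨κ, _, A, B, hK, hone⟩ := h.exists_kraus
  have hv := sum_vecMulVec_of_sum_density hK
  have hψ' := star_dotProduct_eq_one hψ
  have hc := sum_norm_sq_dotProduct hv ψ.ofLp
  rw [hψ', norm_one, one_pow] at hc
  have he := eq_smul_of_sum_vecMulVec hψ' hv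
  set c : κ → ℂ := fun k => star ψ.ofLp ⬝ᵥ ((A k ⊗ₖ B k) *ᵥ φ.ofLp)
  -- Trace preservation: inner products are conserved when summed over branches.
  have key : ∀ y z : Fin p × Fin q → ℂ,
      ∑ k, star ((A k ⊗ₖ B k) *ᵥ y) ⬝ᵥ ((A k ⊗ₖ B k) *ᵥ z) = star y ⬝ᵥ z := by
    intro y z
    have := congrArg (fun X => star y ⬝ᵥ (X *ᵥ z)) hone
    simp only [Matrix.sum_mulVec, dotProduct_sum, Matrix.one_mulVec] at this
    rw [← this]
    refine Finset.sum_congr rfl fun k _ => ?_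
    rw [Matrix.star_mulVec, ← Matrix.mulVec_mulVec, Matrix.dotProduct_mulVec (star y)]
  have hnorm : ∑ k, ((∑ i, ‖(A k *ᵥ a) i‖ ^ 2) * ∑ j, ‖(B k *ᵥ b) j‖ ^ 2) =
      (∑ i, ‖a i‖ ^ 2) * ∑ j, ‖b j‖ ^ 2 := by
    have := key (productVec a b) (productVec a b)
    simp only [star_dotProduct_self_eq, kronecker_mulVec_productVec,
      sum_norm_sq_productVec] at this
    exact_mod_cast this
  have hin : star φ.ofLp ⬝ᵥ productVec a b =
      ∑ k, star (c k) * (star ψ.ofLp ⬝ᵥ productVec (A k *ᵥ a) (B k *ᵥ b)) := by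
    rw [← key]
    refine Finset.sum_congr rfl fun k _ => ?_
    rw [he k, kronecker_mulVec_productVec, star_smul, smul_dotProduct, smul_eq_mul]
  calc _ ≤ (∑ k, ‖star (c k)‖ ^ 2) *
        ∑ k, ‖star ψ.ofLp ⬝ᵥ productVec (A k *ᵥ a) (B k *ᵥ b)‖ ^ 2 := by
        rw [hin]; exact norm_sum_mul_sq_le _ _
    _ = ∑ k, ‖star ψ.ofLp ⬝ᵥ productVec (A k *ᵥ a) (B k *ᵥ b)‖ ^ 2 := by
        simp only [norm_star]; rw [hc, one_mul]
    _ ≤ ∑ k, C * ((∑ i, ‖(A k *ᵥ a) i‖ ^ 2) * ∑ j, ‖(B k *ᵥ b) j‖ ^ 2) :=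
        Finset.sum_le_sum fun k _ => hC _ _
    _ = _ := by rw [← Finset.mul_sum, hnorm]

/-! ## Tensor powers -/

/-- The `n`-th tensor power of a matrix. -/
def matrixPower {I J : Type*} (M : Matrix I J ℂ) (n : ℕ) : Matrix (Fin n → I) (Fin n → J) ℂ :=
  Matrix.of fun x y => ∏ k, M (x k) (y k)

theorem matrixPower_mul {I J L : Type*} [Fintype J] [DecidableEq J] (M : Matrix I J ℂ)
    (N : Matrix J L ℂ) (n : ℕ) :
    matrixPower (M * N) n = matrixPower M n * matrixPower N n := by
  ext x y
  simp only [matrixPower, Matrix.of_apply, Matrix.mul_apply, ← Finset.prod_mul_distrib]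
  rw [Finset.prod_univ_sum, Fintype.piFinset_univ]

theorem matrixPower_one {I : Type*} [DecidableEq I] (n : ℕ) :
    matrixPower (1 : Matrix I I ℂ) n = 1 := by
  ext x y
  simp only [matrixPower, Matrix.of_apply, Matrix.one_apply, Finset.prod_ite_zero, funext_iff]
  simp

theorem coeffMatrix_tensorPower {p q : ℕ} (φ : Vec p q) (n : ℕ) :
    coeffMatrix (tensorPower φ n) =
      (matrixPower (coeffMatrix φ) n).submatrix finFunctionFinEquiv.symm
        finFunctionFinEquiv.symm := rfl

theorem sum_prod_finFunctionFinEquiv {R : Type*} [CommSemiring R] {p n : ℕ} (f : Fin p → R) :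
    ∑ x : Fin (p ^ n), ∏ k, f (finFunctionFinEquiv.symm x k) = (∑ i, f i) ^ n := by
  rw [finFunctionFinEquiv.symm.sum_comp (fun y : Fin n → Fin p => ∏ k, f (y k)),
    ← Fintype.piFinset_univ, ← Finset.prod_univ_sum]
  simp

theorem sum_prod_finFunctionFinEquiv_prod {R : Type*} [CommSemiring R] {p q n : ℕ}
    (f : Fin p × Fin q → R) :
    ∑ x : Fin (p ^ n) × Fin (q ^ n),
      ∏ k, f (finFunctionFinEquiv.symm x.1 k, finFunctionFinEquiv.symm x.2 k) =
        (∑ i, f i) ^ n := by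
  refine (Equiv.sum_comp (finFunctionFinEquiv.symm.prodCongr finFunctionFinEquiv.symm)
    (fun y : (Fin n → Fin p) × (Fin n → Fin q) => ∏ k, f (y.1 k, y.2 k))).trans ?_
  rw [← (Equiv.arrowProdEquivProdArrow (Fin n) (fun _ => Fin p) (fun _ => Fin q)).sum_comp]
  simp only [Equiv.arrowProdEquivProdArrow_apply, Prod.mk.eta]
  rw [← Fintype.piFinset_univ, ← Finset.prod_univ_sum]
  simp

theorem norm_tensorPower {p q : ℕ} {φ : Vec p q} (h : ‖φ‖ = 1) (n : ℕ) :
    ‖tensorPower φ n‖ = 1 := by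
  have h1 : ∑ i, ‖φ i‖ ^ 2 = 1 := by rw [← EuclideanSpace.norm_sq_eq, h, one_pow]
  rw [← sq_eq_sq₀ (norm_nonneg _) zero_le_one, EuclideanSpace.norm_sq_eq]
  simp only [tensorPower, norm_prod, ← Finset.prod_pow]
  rw [sum_prod_finFunctionFinEquiv_prod (fun i => ‖φ i‖ ^ 2), h1]
  simp

/-- Tensor powers of `A` and `B` compress the power of the coefficient matrix to an identity of size
`card S ^ n`; only this lower bound on the rank is needed. -/
theorem pow_le_rank_tensorPower {p q : ℕ} {φ : Vec p q} {S : Type*} [Fintype S] [DecidableEq S]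
    (A : Matrix S (Fin p) ℂ) (B : Matrix (Fin q) S ℂ) (h : A * coeffMatrix φ * B = 1) (n : ℕ) :
    Fintype.card S ^ n ≤ (coeffMatrix (tensorPower φ n)).rank := by
  have h1 : matrixPower A n * matrixPower (coeffMatrix φ) n * matrixPower B n = 1 := by
    rw [← matrixPower_mul, ← matrixPower_mul, h, matrixPower_one]
  have h2 := congrArg Matrix.rank h1
  rw [Matrix.rank_one, Fintype.card_fun, Fintype.card_fin] at h2
  rw [← h2, coeffMatrix_tensorPower, Matrix.rank_submatrix]
  exact (Matrix.rank_mul_le_left _ _).trans (Matrix.rank_mul_le_right _ _)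

/-- The tensor power of a vector. -/
def vecPower {p : ℕ} (u : Fin p → ℂ) (n : ℕ) : Fin (p ^ n) → ℂ :=
  fun x => ∏ k, u (finFunctionFinEquiv.symm x k)

theorem sum_norm_sq_vecPower {p : ℕ} (u : Fin p → ℂ) (n : ℕ) :
    ∑ i, ‖vecPower u n i‖ ^ 2 = (∑ i, ‖u i‖ ^ 2) ^ n := by
  simp only [vecPower, norm_prod, ← Finset.prod_pow]
  exact sum_prod_finFunctionFinEquiv (fun i => ‖u i‖ ^ 2)

theorem tensorPower_overlap {p q : ℕ} (φ : Vec p q) (u : Fin p → ℂ) (v : Fin q → ℂ) (n : ℕ) :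
    star (tensorPower φ n).ofLp ⬝ᵥ productVec (vecPower u n) (vecPower v n) =
      (star φ.ofLp ⬝ᵥ productVec u v) ^ n := by
  simp only [dotProduct]
  rw [← sum_prod_finFunctionFinEquiv_prod]
  refine Finset.sum_congr rfl fun x _ => ?_
  simp [tensorPower, productVec, vecPower, Finset.prod_mul_distrib]

/-! ## Powers of the standard maximally entangled state -/

theorem norm_maxEntangled {d : ℕ} (hd : 1 ≤ d) : ‖maxEntangled d‖ = 1 := by
  have h0 : (0 : ℝ) < d := by exact_mod_cast hd
  rw [← sq_eq_sq₀ (norm_nonneg _) zero_le_one, EuclideanSpace.norm_sq_eq, Fintype.sum_prod_type]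
  have h1 : ∀ i j : Fin d, ‖(maxEntangled d) (i, j)‖ ^ 2 = if i = j then (1 / d : ℝ) else 0 := by
    intro i j
    simp only [maxEntangled]
    split_ifs
    · rw [Complex.norm_real, Real.norm_eq_abs, sq_abs, div_pow, Real.sq_sqrt h0.le, one_pow]
    · simp
  simp only [h1]
  simp [h0.ne']

theorem tensorPower_maxEntangled_apply (d m : ℕ) (i j : Fin (d ^ m)) :
    tensorPower (maxEntangled d) m (i, j) =
      if i = j then ((1 / Real.sqrt d : ℝ) : ℂ) ^ m else 0 := by
  simp only [tensorPower, maxEntangled, Finset.prod_ite_zero]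
  have : (∀ k ∈ Finset.univ, finFunctionFinEquiv.symm i k = finFunctionFinEquiv.symm j k) ↔
      i = j := by
    rw [← finFunctionFinEquiv.symm.injective.eq_iff, funext_iff]; simp
  simp only [this, Finset.prod_const, Finset.card_univ, Fintype.card_fin]

/-- The coefficient matrix is a scalar multiple of the identity, so this is Cauchy–Schwarz for `∑ i,
u i * v i`. -/
theorem tensorPower_maxEntangled_overlap_le (d m : ℕ) (u v : Fin (d ^ m) → ℂ) :
    ‖star (tensorPower (maxEntangled d) m).ofLp ⬝ᵥ productVec u v‖ ^ 2 ≤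
      (1 / (d : ℝ) ^ m) * ((∑ i, ‖u i‖ ^ 2) * ∑ j, ‖v j‖ ^ 2) := by
  have h : star (tensorPower (maxEntangled d) m).ofLp ⬝ᵥ productVec u v =
      ((1 / Real.sqrt d : ℝ) : ℂ) ^ m * ∑ i, u i * v i := by
    simp only [dotProduct, Fintype.sum_prod_type, Pi.star_apply, tensorPower_maxEntangled_apply,
      productVec, apply_ite star, star_zero, ite_mul, zero_mul, Finset.sum_ite_eq,
      Finset.mem_univ, if_true, Finset.mul_sum]
    simp
  have h2 : ‖((1 / Real.sqrt d : ℝ) : ℂ) ^ m‖ ^ 2 = 1 / (d : ℝ) ^ m := by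
    rw [norm_pow, Complex.norm_real, Real.norm_eq_abs, ← pow_mul, mul_comm, pow_mul, sq_abs,
      div_pow, Real.sq_sqrt (Nat.cast_nonneg d), one_pow, div_pow, one_pow]
  rw [h, norm_mul, mul_pow, h2]
  gcongr
  exact norm_sum_mul_sq_le u v

/-! ## Schmidt decomposition -/

/-- A Schmidt decomposition with squared Schmidt coefficients `l`: `e` is an orthonormal family,
the vectors `g k` are pairwise orthogonal with `‖g k‖² = l k > 0`, and `φ = ∑ k, e k ⊗ g k`. -/
theorem exists_schmidt {p q : ℕ} (φ : Vec p q) :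
    ∃ (r : ℕ) (l : Fin r → ℝ) (e : Matrix (Fin p) (Fin r) ℂ) (g : Matrix (Fin r) (Fin q) ℂ),
      (∀ k, 0 < l k) ∧ eᴴ * e = 1 ∧ g * gᴴ = Matrix.diagonal (fun k => (l k : ℂ)) ∧
        coeffMatrix φ = e * g := by
  set N := coeffMatrix φ
  have hH : (N * Nᴴ).IsHermitian := Matrix.isHermitian_mul_conjTranspose_self N
  have hpos : (N * Nᴴ).PosSemidef := Matrix.posSemidef_self_mul_conjTranspose N
  set U : Matrix (Fin p) (Fin p) ℂ := ↑hH.eigenvectorUnitary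
  have hU1 : Uᴴ * U = 1 := Matrix.mem_unitaryGroup_iff'.mp hH.eigenvectorUnitary.2
  have hU2 : U * Uᴴ = 1 := Matrix.mem_unitaryGroup_iff.mp hH.eigenvectorUnitary.2
  set lam := hH.eigenvalues
  have hD : (Uᴴ * N) * (Uᴴ * N)ᴴ = Matrix.diagonal (fun k => (lam k : ℂ)) := by
    have := hH.conjStarAlgAut_star_eigenvectorUnitary
    rw [Unitary.conjStarAlgAut_star_apply] at this
    rw [Matrix.conjTranspose_mul, Matrix.conjTranspose_conjTranspose]
    simpa [Matrix.mul_assoc, Matrix.star_eq_conjTranspose, Function.comp_def] using this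
  -- Only the nonzero eigenvalues of `N * Nᴴ` are kept; the row of `Uᴴ * N` at a zero eigenvalue has
  -- norm 0, so nothing is lost.
  let S := {i : Fin p // lam i ≠ 0}
  let eq := (Fintype.equivFin S).symm
  let ι : Fin (Fintype.card S) → Fin p := fun k => (eq k).1
  have hι : Function.Injective ι := Subtype.val_injective.comp eq.injective
  refine ⟨Fintype.card S, fun k => lam (ι k), U.submatrix id ι, (Uᴴ * N).submatrix ι id,
    fun k => lt_of_le_of_ne (hpos.eigenvalues_nonneg _) (Ne.symm (eq k).2), ?_, ?_, ?_⟩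
  · rw [Matrix.conjTranspose_submatrix, ← Matrix.submatrix_mul _ _ _ _ _ Function.bijective_id, hU1,
      Matrix.submatrix_one _ hι]
  · rw [Matrix.conjTranspose_submatrix, ← Matrix.submatrix_mul _ _ _ _ _ Function.bijective_id, hD,
      Matrix.submatrix_diagonal _ _ hι]
    rfl
  · have hz : ∀ i, lam i = 0 → ∀ j, (Uᴴ * N) i j = 0 := by
      intro i hi
      have h1 := congrFun (congrFun hD i) i
      rw [Matrix.diagonal_apply_eq, hi] at h1
      have h2 : star ((Uᴴ * N) i) ⬝ᵥ (Uᴴ * N) i = 0 :=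
        (dotProduct_comm _ _).trans (h1.trans Complex.ofReal_zero)
      exact congrFun (dotProduct_star_self_eq_zero.mp h2)
    have hN : N = U * (Uᴴ * N) := by rw [← Matrix.mul_assoc, hU2, Matrix.one_mul]
    ext i j
    conv_lhs => rw [hN]
    simp only [Matrix.mul_apply (M := U), Matrix.mul_apply (M := U.submatrix id ι),
      Matrix.submatrix_apply, id]
    rw [eq.sum_comp (fun s : S => U i s.1 * (Uᴴ * N) s.1 j),
      ← Finset.sum_filter_of_ne (p := fun k => lam k ≠ 0) fun k _ hk h0 => hk (by simp [hz k h0])]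
    exact Finset.sum_subtype _ (by simp) _

theorem sum_norm_sq_eq_trace {p q : ℕ} (φ : Vec p q) :
    ((∑ x, ‖φ x‖ ^ 2 : ℝ) : ℂ) = (coeffMatrix φ * (coeffMatrix φ)ᴴ).trace := by
  push_cast
  simp only [Matrix.trace, Matrix.diag, Matrix.mul_apply, Fintype.sum_prod_type,
    Matrix.conjTranspose_apply, coeffMatrix, Matrix.of_apply]
  exact Finset.sum_congr rfl fun _ _ => Finset.sum_congr rfl fun _ _ =>
    (Complex.mul_conj' _).symm

theorem star_dotProduct_productVec {p q : ℕ} (φ : Vec p q) (u : Fin p → ℂ) (v : Fin q → ℂ) :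
    star φ.ofLp ⬝ᵥ productVec u v = star (star u ᵥ* coeffMatrix φ) ⬝ᵥ v := by
  simp only [dotProduct, Fintype.sum_prod_type, productVec, Matrix.vecMul, coeffMatrix,
    Pi.star_apply, star_sum, star_mul', star_star, Finset.sum_mul, Matrix.of_apply]
  rw [Finset.sum_comm]
  exact Finset.sum_congr rfl fun _ _ => Finset.sum_congr rfl fun _ _ => by ring

theorem isMaximallyEntangled_of_schmidt {p q r : ℕ} {φ : Vec p q} (hr : 2 ≤ r)
    {e : Matrix (Fin p) (Fin r) ℂ} {g : Matrix (Fin r) (Fin q) ℂ} (he : eᴴ * e = 1)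
    (hg : g * gᴴ = Matrix.diagonal fun _ => ((1 / r : ℝ) : ℂ)) (h : coeffMatrix φ = e * g) :
    IsMaximallyEntangled φ := by
  have h0 : (0 : ℝ) < r := by exact_mod_cast (by omega : 0 < r)
  have hs : Real.sqrt r ≠ 0 := (Real.sqrt_pos.mpr h0).ne'
  -- Each row of `g` has squared norm `1 / r`, so the factor `√r` normalises it.
  refine ⟨r, hr, fun k => WithLp.toLp 2 fun i => e i k,
    fun k => WithLp.toLp 2 fun j => ((Real.sqrt r : ℝ) : ℂ) * g k j, ?_, ?_, ?_⟩
  · rw [orthonormal_iff_ite]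
    intro k l
    have := congrFun (congrFun he k) l
    rw [Matrix.mul_apply, Matrix.one_apply] at this
    rw [← this, PiLp.inner_apply]
    simp [mul_comm]
  · rw [orthonormal_iff_ite]
    intro k l
    have := congrFun (congrFun hg l) k
    rw [Matrix.mul_apply, Matrix.diagonal_apply] at this
    have h2 : ((Real.sqrt r : ℝ) : ℂ) * ((Real.sqrt r : ℝ) : ℂ) = r := by
      rw [← Complex.ofReal_mul, Real.mul_self_sqrt h0.le]; simp
    have h3 : (r : ℂ) ≠ 0 := by exact_mod_cast h0.ne'
    calc _ = (r : ℂ) * ∑ j, g l j * gᴴ j k := by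
          rw [PiLp.inner_apply, Finset.mul_sum, ← h2]
          refine Finset.sum_congr rfl fun j _ => ?_
          simp only [RCLike.inner_apply, map_mul, Complex.conj_ofReal, Matrix.conjTranspose_apply,
            ← starRingEnd_apply]
          ring
      _ = _ := by
          rw [this]
          by_cases hkl : k = l
          · simp [hkl, h3]
          · simp [hkl, Ne.symm hkl]
  · intro i j
    have := congrFun (congrFun h i) j
    rw [Matrix.mul_apply] at this
    change φ (i, j) = _ at this
    rw [this, Finset.mul_sum]
    refine Finset.sum_congr rfl fun k _ => ?_
    have h4 : ((Real.sqrt r : ℝ) : ℂ) ≠ 0 := by exact_mod_cast hs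
    push_cast
    field_simp

theorem isSeparable_of_schmidt {p q : ℕ} {φ : Vec p q}
    {e : Matrix (Fin p) (Fin 1) ℂ} {g : Matrix (Fin 1) (Fin q) ℂ} (h : coeffMatrix φ = e * g) :
    IsSeparable φ := by
  refine ⟨WithLp.toLp 2 fun i => e i 0, WithLp.toLp 2 fun j => g 0 j, fun i j => ?_⟩
  have := congrFun (congrFun h i) j
  simpa [Matrix.mul_apply, coeffMatrix] using this

/-- From `l k ^ n ≤ 1 / D ≤ 1 / r ^ n` no `l k` exceeds the average `1 / r`, so all equal it;
substituting back gives `D ≤ r ^ n`. -/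
theorem eq_one_div_of_pow_le {r n : ℕ} (hn : 0 < n) {l : Fin r → ℝ} {D : ℝ}
    (hl : ∀ k, 0 < l k) (hsum : ∑ k, l k = 1) (hrD : (r : ℝ) ^ n ≤ D)
    (hlD : ∀ k, l k ^ n ≤ 1 / D) : (∀ k, l k = 1 / r) ∧ (r : ℝ) ^ n = D := by
  have hr : 0 < r := by
    rcases Nat.eq_zero_or_pos r with rfl | h
    · simp at hsum
    · exact h
  have hr0 : (0 : ℝ) < r := by exact_mod_cast hr
  have hD : 0 < D := (pow_pos hr0 n).trans_le hrD
  have hle : ∀ k, l k ≤ 1 / r := fun k => by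
    refine le_of_pow_le_pow_left₀ hn.ne' (by positivity) ((hlD k).trans ?_)
    rw [div_pow, one_pow]
    exact one_div_le_one_div_of_le (by positivity) hrD
  have heq : ∀ k, l k = 1 / r := fun k =>
    (Finset.sum_eq_sum_iff_of_le fun k _ => hle k).mp
      (by rw [hsum]; simp [hr0.ne']) k (Finset.mem_univ k)
  refine ⟨heq, le_antisymm hrD ?_⟩
  have := hlD ⟨0, hr⟩
  rw [heq, div_pow, one_pow] at this
  exact (one_div_le_one_div (by positivity) hD).mp this

end Entanglement

/-! ### The main theorem -/

open Entanglement

theorem theorem4p4 {dA dB d : ℕ} (φ : Entanglement.Vec dA dB) (hφ : ‖φ‖ = 1)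
    (hmax : ¬ Entanglement.IsMaximallyEntangled φ) (hd : 1 ≤ d)
    (hsep : d = 1 → ¬ Entanglement.IsSeparable φ) :
    ¬ ∃ n m : ℕ, 0 < n ∧ 0 < m ∧
      Entanglement.Interconvertible (Entanglement.tensorPower φ n)
        (Entanglement.tensorPower (Entanglement.maxEntangled d) m) := by
  rintro ⟨n, m, hn, hm, hto, hfrom⟩
  obtain ⟨r, l, e, g, hl, he, hg, hφeg⟩ := exists_schmidt φ
  have hsum : ∑ k, l k = 1 := by
    have h := sum_norm_sq_eq_trace φ
    rw [← EuclideanSpace.norm_sq_eq, hφ, one_pow, hφeg, Matrix.conjTranspose_mul, Matrix.mul_assoc,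
      Matrix.trace_mul_comm, Matrix.mul_assoc, Matrix.mul_assoc, he, Matrix.mul_one, hg,
      Matrix.trace_diagonal] at h
    exact_mod_cast h.symm
  have hrank : (r : ℝ) ^ n ≤ (d : ℝ) ^ m := by
    -- `eᴴ` is a left inverse of `e`, and `gᴴ` rescaled by `1 / l k` is a right inverse of `g`.
    have hinv : eᴴ * coeffMatrix φ * (gᴴ * Matrix.diagonal fun k => (l k : ℂ)⁻¹) = 1 := by
      rw [hφeg, ← Matrix.mul_assoc eᴴ, he, Matrix.one_mul, ← Matrix.mul_assoc, hg,
        Matrix.diagonal_mul_diagonal, ← Matrix.diagonal_one]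
      congr 1
      ext k
      exact mul_inv_cancel₀ (by exact_mod_cast (hl k).ne')
    have h1 := pow_le_rank_tensorPower _ _ hinv n
    have h2 := hfrom.rank_le (norm_tensorPower hφ n)
    have h3 := (coeffMatrix (tensorPower (maxEntangled d) m)).rank_le_card_width
    rw [Fintype.card_fin] at h1 h3
    exact_mod_cast h1.trans (h2.trans h3)
  have hlmax : ∀ k, l k ^ n ≤ 1 / (d : ℝ) ^ m := by
    intro k
    have hu : ∑ i, ‖e i k‖ ^ 2 = 1 := by
      have h := congrFun (congrFun he k) k
      rw [Matrix.one_apply_eq] at h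
      have h' := (star_dotProduct_self_eq fun i => e i k).symm.trans h
      exact_mod_cast h'
    have hgk : star (g k) ⬝ᵥ g k = l k := by
      have h := congrFun (congrFun hg k) k
      rw [Matrix.diagonal_apply_eq] at h
      rw [dotProduct_comm]
      exact h
    have hv : ∑ j, ‖g k j‖ ^ 2 = l k := by
      rw [star_dotProduct_self_eq] at hgk
      exact_mod_cast hgk
    have hug : star (fun i => e i k) ᵥ* coeffMatrix φ = g k := by
      have h : eᴴ * coeffMatrix φ = g := by rw [hφeg, ← Matrix.mul_assoc, he, Matrix.one_mul]
      exact congrFun h k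
    -- Tested on the `n`-th power of `e k ⊗ g k`, with `g k` left unnormalised: the overlap and the
    -- squared norm both equal `l k ^ n`, so one factor cancels.
    have h := hto.overlap_le (norm_tensorPower (norm_maxEntangled hd) m)
      (tensorPower_maxEntangled_overlap_le d m) (vecPower (fun i => e i k) n) (vecPower (g k) n)
    rw [tensorPower_overlap, star_dotProduct_productVec, hug, hgk, sum_norm_sq_vecPower,
      sum_norm_sq_vecPower, hu, hv, one_pow, one_mul, norm_pow, Complex.norm_real,
      Real.norm_of_nonneg (hl k).le, sq] at h
    exact le_of_mul_le_mul_right h (pow_pos (hl k) n)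
  obtain ⟨hflat, hrn⟩ := eq_one_div_of_pow_le hn hl hsum hrank hlmax
  have hrn' : r ^ n = d ^ m := by exact_mod_cast hrn
  obtain h2 | rfl | rfl : 2 ≤ r ∨ r = 1 ∨ r = 0 := by omega
  · exact hmax (isMaximallyEntangled_of_schmidt h2 he (by simpa only [hflat] using hg) hφeg)
  · rw [one_pow] at hrn'
    exact hsep ((Nat.pow_eq_one.mp hrn'.symm).resolve_right hm.ne') (isSeparable_of_schmidt hφeg)
  · simp at hsum
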